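/- Let ${\bf f} = f_0f_1f_2\cdots = 01001010\cdots$ be the infinite Fibonacci word, i.e. the fixed point, starting with $0$, of the morphism $0 \mapsto 01$, $1 \mapsto 0$. Let $T$ be the transducer with two states $q_0$ (initial) and $q_1$ and the following transitions: in state $q_0$ it moves to $q_1$, writing $00$ on reading $0$ and writing $0$ on reading $1$; in state $q_1$ it moves to $q_0$, writing $11$ on reading $0$ and writing $1$ on reading $1$. The Rote-Fibonacci word ${\bf r} = 001001101101100100\cdots$ is the output of $T$, started in $q_0$, on input ${\bf f}$. A finite word $w$ has period $p \geq 1$ if $w[i] = w[i+p]$ for all $i$ for which both sides are defined. The exponent of a nonempty finite word $w$ is $|w|/P$, where $P$ is the smallest period of $w$, and the critical exponent of an infinite word is the supremum of the exponents of all its nonempty factors (finite blocks of consecutive letters). **Corollary.** The critical exponent of the Rote-Fibonacci word ${\bf r}$ is $2+\alpha$, where $\alpha = (1+\sqrt{5})/2$ is the golden ratio. -/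

import Mathlib

namespace RoteFibonacci

/-- The action of a morphism, given by the images of the letters, on finite words. -/
def applyMorphism {A B : Type*} (h : A → List B) (w : List A) : List B := w.flatMap h

/-- The Fibonacci morphism `0 ↦ 01`, `1 ↦ 0`. -/
def fibMorphism : Fin 2 → List (Fin 2) := ![[0, 1], [0]]

/-- The `n`-th iterate of the Fibonacci morphism on the one-letter word `0`. -/
def fibIterate (n : ℕ) : List (Fin 2) := (applyMorphism fibMorphism)^[n] [0]

theorem fibIterate_succ (n : ℕ) :
    fibIterate (n + 1) = applyMorphism fibMorphism (fibIterate n) :=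
  Function.iterate_succ_apply' _ _ _

theorem length_le_length_applyMorphism (w : List (Fin 2)) :
    w.length ≤ (applyMorphism fibMorphism w).length := by
  induction w with
  | nil => simp [applyMorphism]
  | cons a w ih =>
    simp only [applyMorphism, List.flatMap_cons, List.length_append, List.length_cons] at ih ⊢
    have : 1 ≤ (fibMorphism a).length := by fin_cases a <;> simp [fibMorphism]
    omega

theorem fibIterate_eq_cons (n : ℕ) :
    ∃ w, fibIterate n = 0 :: w ∧ n + 1 ≤ (fibIterate n).length := by
  induction n with
  | zero => exact ⟨[], by simp [fibIterate]⟩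
  | succ n ih =>
    obtain ⟨w, hw, hl⟩ := ih
    refine ⟨1 :: applyMorphism fibMorphism w, ?_, ?_⟩
    · rw [fibIterate_succ, hw]
      simp [applyMorphism, fibMorphism]
    · have := length_le_length_applyMorphism w
      rw [fibIterate_succ, hw]
      rw [hw] at hl
      simp [applyMorphism, fibMorphism] at this hl ⊢
      omega

theorem lt_length_fibIterate (n : ℕ) : n < (fibIterate n).length :=
  (fibIterate_eq_cons n).choose_spec.2

/-- The infinite Fibonacci word `f = 01001010⋯`, the fixed point of the Fibonacci morphism that
starts with `0`. -/
def fibWord (n : ℕ) : Fin 2 := (fibIterate n)[n]'(lt_length_fibIterate n)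

/-- The finite word `x[i] x[i+1] ⋯ x[i+n-1]`. -/
def factorAt {A : Type*} (x : ℕ → A) (i n : ℕ) : List A := (List.range n).map fun k => x (i + k)

/-- The states of the transducer; the initial state is `q₀`. -/
inductive State
  | q₀
  | q₁

/-- The transition function of the transducer: every letter exchanges the two states. -/
def next : State → Fin 2 → State
  | .q₀, _ => .q₁
  | .q₁, _ => .q₀

/-- The output function of the transducer: `0/00` and `1/0` on the transition from `q₀` to `q₁`,
and `0/11` and `1/1` on the transition from `q₁` to `q₀`. -/
def out : State → Fin 2 → List (Fin 2)
  | .q₀ => ![[0, 0], [0]]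
  | .q₁ => ![[1, 1], [1]]

/-- The output of the transducer on a finite word, when started in a given state. -/
def transduce : State → List (Fin 2) → List (Fin 2)
  | _, [] => []
  | q, a :: w => out q a ++ transduce (next q a) w

theorem length_le_length_transduce (q : State) (w : List (Fin 2)) :
    w.length ≤ (transduce q w).length := by
  induction w generalizing q with
  | nil => simp
  | cons a w ih =>
    have h1 : 1 ≤ (out q a).length := by cases q <;> fin_cases a <;> simp [out]
    have h2 := ih (next q a)
    simp only [transduce, List.length_append, List.length_cons]
    omega

theorem lt_length_transduce (n : ℕ) :
    n < (transduce .q₀ (factorAt fibWord 0 (n + 1))).length := by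
  have := length_le_length_transduce .q₀ (factorAt fibWord 0 (n + 1))
  simp only [factorAt, List.length_map, List.length_range] at this ⊢
  omega

/-- The Rote-Fibonacci word `r = 0010011011⋯`: the output of the transducer, started in `q₀`, on
the infinite Fibonacci word. The letter `r[n]` is read off from the output on the prefix of length
`n + 1`, which has at least `n + 1` letters. -/
def roteFibWord (n : ℕ) : Fin 2 :=
  (transduce .q₀ (factorAt fibWord 0 (n + 1)))[n]'(lt_length_transduce n)

/-- The smallest period of a finite word: the least `p ≥ 1` such that `w[i] = w[i+p]` whenever
both sides are meaningful. -/
noncomputable def minPeriod {A : Type*} (w : List A) : ℕ := sInf {p : ℕ | 1 ≤ p ∧ w.HasPeriod p}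

/-- The smallest period exists, and for a nonempty word it is at most the length. -/
theorem minPeriod_spec {A : Type*} (w : List A) :
    1 ≤ minPeriod w ∧ w.HasPeriod (minPeriod w) ∧ (w ≠ [] → minPeriod w ≤ w.length) := by
  have hne : {p : ℕ | 1 ≤ p ∧ w.HasPeriod p}.Nonempty :=
    ⟨w.length + 1, by omega, List.hasPeriod_of_length_le w _ (by omega)⟩
  refine ⟨(Nat.sInf_mem hne).1, (Nat.sInf_mem hne).2, fun hw => Nat.sInf_le ⟨?_, ?_⟩⟩
  · exact List.length_pos_iff.mpr hw
  · exact List.hasPeriod_of_length_le w _ le_rfl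

/-- The exponent `|w| / P` of a finite word `w` with smallest period `P`. -/
noncomputable def exponent {A : Type*} (w : List A) : ℝ := (w.length : ℝ) / (minPeriod w : ℝ)

/-- `w` is a factor of the infinite word `x`. -/
def IsFactor {A : Type*} (w : List A) (x : ℕ → A) : Prop := ∃ i n : ℕ, w = factorAt x i n

/-- The critical exponent of an infinite word: the supremum, in the extended reals, of the
exponents of its nonempty factors. -/
noncomputable def criticalExponent {A : Type*} (x : ℕ → A) : EReal :=
  ⨆ (w : List A) (_ : w ≠ [] ∧ IsFactor w x), (exponent w : EReal)

end RoteFibonacci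

/-! Write φ for `invGolden`. The letter r[n] is the parity of ⌊(n+2)φ⌋ + 1, so r codes a rotation
(`roteFibWord_val`). For d = pφ - 2m with |d| < 1, the letters r[k] and r[k+p] differ exactly when
an integer separates (k+2)φ from (k+2)φ + d.

Upper bound: if φ^(n+1) ≤ |d| < φ^n, best approximation gives p ≥ F(n+1) (`fib_le_of_abs_lt`), and a
mismatch occurs within F(n+3) steps (`exists_rotation_mem`). A repetition thus has length at most p
+ F(n+3) - 1 ≤ (3+φ)p, and 3 + φ = 2 + α.

Lower bound: for p = F(n+1) with 6 ∣ n, there are F(n+3) - 1 consecutive matches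
(`roteFibWord_run`), and the exponents tend to 3 + φ. -/

namespace RoteFibonacci

/-! ### Diophantine approximation of the inverse golden ratio -/

/-- The reciprocal `(√5 - 1) / 2` of the golden ratio. -/
noncomputable def invGolden : ℝ := (Real.sqrt 5 - 1) / 2

theorem invGolden_sq : invGolden ^ 2 = 1 - invGolden := by
  have h := Real.sq_sqrt (show (0 : ℝ) ≤ 5 by norm_num)
  unfold invGolden
  nlinarith

theorem half_lt_invGolden : 1 / 2 < invGolden := by
  have h : (2 : ℝ) < Real.sqrt 5 := Real.lt_sqrt_of_sq_lt (by norm_num)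
  unfold invGolden
  linarith

theorem invGolden_pos : 0 < invGolden := by linarith [half_lt_invGolden]

theorem invGolden_lt_one : invGolden < 1 := by nlinarith [invGolden_sq, invGolden_pos]

theorem invGolden_pow_add_two (n : ℕ) : invGolden ^ (n + 2) = invGolden ^ n - invGolden ^ (n + 1) := by
  rw [pow_add, invGolden_sq, pow_succ]
  ring

theorem invGolden_pow_pos (n : ℕ) : 0 < invGolden ^ n := pow_pos invGolden_pos n

theorem invGolden_pow_le_one (n : ℕ) : invGolden ^ n ≤ 1 := pow_le_one₀ invGolden_pos.le invGolden_lt_one.le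

theorem irrational_invGolden : Irrational invGolden := by
  have h : Irrational (Real.sqrt 5) := by
    simpa using (Nat.Prime.irrational_sqrt (p := 5) (by norm_num))
  have h2 := (h.sub_natCast 1).div_natCast (m := 2) (by norm_num)
  simpa [invGolden] using h2

theorem fib_mul_invGolden (n : ℕ) :
    (Nat.fib (n + 1) : ℝ) * invGolden = Nat.fib n + (-1) ^ n * invGolden ^ (n + 1) := by
  induction n using Nat.twoStepInduction with
  | zero => simp
  | one => simp [invGolden_sq]
  | more n h1 h2 =>
    rw [Nat.fib_add_two (n := n + 1)]
    push_cast
    rw [add_mul, h1, h2, Nat.fib_add_two (n := n), show n + 2 + 1 = n + 1 + 2 from rfl, invGolden_pow_add_two (n + 1)]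
    push_cast
    ring

/-- The orbit of a point under the rotation by `invGolden` meets every half-open arc of length
`invGolden ^ n` within `fib (n + 2)` steps. -/
theorem exists_rotation_mem (n : ℕ) (y : ℝ) :
    ∃ j < Nat.fib (n + 2), ∃ z : ℤ, y + j * invGolden < z ∧ z ≤ y + j * invGolden + invGolden ^ n := by
  induction n with
  | zero =>
    refine ⟨0, by simp, ⌊y⌋ + 1, ?_, ?_⟩
    · simp
    · simpa using Int.floor_le y
  | succ n ih =>
    obtain ⟨j, hj, z, h1, h2⟩ := ih
    have hfib : Nat.fib (n + 1 + 2) = Nat.fib (n + 1) + Nat.fib (n + 2) := Nat.fib_add_two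
    have e0 := invGolden_pow_add_two n
    have e1 := invGolden_pow_add_two (n + 1)
    have p1 := invGolden_pow_pos (n + 1)
    have p2 := invGolden_pow_pos (n + 2)
    have p3 := invGolden_pow_pos (n + 3)
    have f1 := fib_mul_invGolden n
    have f2 := fib_mul_invGolden (n + 1)
    simp only [show n + 1 + 1 = n + 2 from rfl, show n + 1 + 2 = n + 3 from rfl] at *
    by_cases h : z ≤ y + j * invGolden + invGolden ^ (n + 1)
    · exact ⟨j, by omega, z, h1, h⟩
    push Not at h
    -- The integer lies in the far part of the arc. Advancing F(n+1) steps moves the point by (-1)^n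
    -- φ^(n+1) modulo 1. For odd n one goes back F(n+1) steps, or, if j is too small, forward F(n+2)
    -- steps, a shift by φ^(n+2).
    rcases Nat.even_or_odd n with hn | hn
    · rw [hn.neg_one_pow] at f1
      refine ⟨j + Nat.fib (n + 1), by omega, z + Nat.fib n, ?_, ?_⟩ <;> push_cast <;> linarith
    · rw [hn.neg_one_pow] at f1
      rw [hn.add_one.neg_one_pow] at f2
      by_cases hjn : Nat.fib (n + 1) ≤ j
      · refine ⟨j - Nat.fib (n + 1), by omega, z - Nat.fib n, ?_, ?_⟩ <;>
          push_cast [hjn] <;> linarith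
      · refine ⟨j + Nat.fib (n + 2), by omega, z + Nat.fib (n + 1), ?_, ?_⟩ <;>
          push_cast <;> linarith

/-- The Fibonacci numbers are the denominators of the best approximations of `invGolden`. -/
theorem fib_le_of_abs_lt (n p : ℕ) (q : ℤ) (hp : 1 ≤ p) (h : |p * invGolden - q| < invGolden ^ n) :
    Nat.fib (n + 1) ≤ p := by
  induction n generalizing p q with
  | zero => simpa using hp
  | succ n ih =>
    rcases n with _ | n
    · simpa using hp
    have hpR : (1 : ℝ) ≤ p := by exact_mod_cast hp
    have e0 := invGolden_pow_add_two n
    have hle := invGolden_pow_le_one n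
    have pn := invGolden_pow_pos (n + 2)
    simp only [show n + 1 + 1 = n + 2 from rfl] at *
    have hq : 1 ≤ q := by
      have h3 : (0 : ℝ) < q := by
        have := (abs_lt.mp h).2
        have h4 : invGolden ^ (n + 2) ≤ invGolden := by
          simpa using pow_le_pow_of_le_one invGolden_pos.le invGolden_lt_one.le (show 1 ≤ n + 2 by omega)
        nlinarith [invGolden_pos]
      have : (0 : ℤ) < q := by exact_mod_cast h3
      omega
    lift q to ℕ using by omega
    -- Descent: pφ - q = -φ(qφ - (p - q)), so (q, p - q) is an approximation one level lower.
    have key : |(q : ℝ) * invGolden - ((p : ℤ) - (q : ℤ) : ℤ)| < invGolden ^ (n + 1) := by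
      have e : (p * invGolden - ((q : ℤ) : ℝ)) =
          -invGolden * ((q : ℝ) * invGolden - ((p : ℤ) - (q : ℤ) : ℤ)) := by
        push_cast
        linear_combination (q : ℝ) * invGolden_sq
      rw [e, abs_mul, abs_neg, abs_of_pos invGolden_pos, pow_succ' invGolden (n + 1)] at h
      exact lt_of_mul_lt_mul_left h invGolden_pos.le
    have hqf := ih q _ (by exact_mod_cast hq) key
    have f := fib_mul_invGolden (n + 1)
    have hfib : Nat.fib (n + 2 + 1) = Nat.fib (n + 1) + Nat.fib (n + 2) := Nat.fib_add_two
    simp only [show n + 1 + 1 = n + 2 from rfl] at *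
    have hqf' : (Nat.fib (n + 2) : ℝ) ≤ q := by exact_mod_cast hqf
    have k1 := (abs_lt.mp key).2
    have k2 : -invGolden ^ (n + 2) ≤ ((-1 : ℝ)) ^ (n + 1) * invGolden ^ (n + 2) := by
      rcases neg_one_pow_eq_or ℝ (n + 1) with h | h <;> rw [h] <;> linarith
    push_cast at k1
    have hmul : (Nat.fib (n + 2) : ℝ) * invGolden ≤ q * invGolden :=
      mul_le_mul_of_nonneg_right hqf' invGolden_pos.le
    have : (Nat.fib (n + 2 + 1) : ℝ) < p + 1 := by
      rw [hfib]
      push_cast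
      linarith
    have : Nat.fib (n + 2 + 1) < p + 1 := by exact_mod_cast this
    omega

/-! ### Zeros in prefixes of the Fibonacci word -/

theorem applyMorphism_append {A B : Type*} (h : A → List B) (u v : List A) :
    applyMorphism h (u ++ v) = applyMorphism h u ++ applyMorphism h v := by
  simp [applyMorphism]

theorem applyMorphism_prefix {A B : Type*} (h : A → List B) {u v : List A} (huv : u <+: v) :
    applyMorphism h u <+: applyMorphism h v := by
  obtain ⟨t, rfl⟩ := huv
  exact ⟨_, (applyMorphism_append h u t).symm⟩

theorem fibIterate_prefix {m n : ℕ} (h : m ≤ n) : fibIterate m <+: fibIterate n := by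
  have step (k : ℕ) : fibIterate k <+: fibIterate (k + 1) := by
    induction k with
    | zero => exact ⟨[1], by decide⟩
    | succ k ih =>
      rw [fibIterate_succ k, fibIterate_succ (k + 1)]
      exact applyMorphism_prefix _ ih
  induction n, h using Nat.le_induction with
  | base => exact List.prefix_refl _
  | succ n _ ih => exact ih.trans (step n)

theorem factorAt_fibWord_prefix (n : ℕ) : factorAt fibWord 0 n <+: fibIterate n := by
  rw [List.prefix_iff_getElem]
  refine ⟨by simpa [factorAt] using (lt_length_fibIterate n).le, fun k hk => ?_⟩
  have hk' : k < n := by simpa [factorAt] using hk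
  simp only [factorAt, List.getElem_map, List.getElem_range, Nat.zero_add, fibWord]
  exact (fibIterate_prefix hk'.le).getElem _

theorem count_applyMorphism (w : List (Fin 2)) :
    (applyMorphism fibMorphism w).count 0 = w.length := by
  induction w with
  | nil => rfl
  | cons a w ih =>
    simp only [applyMorphism, List.flatMap_cons, List.count_append, List.length_cons] at ih ⊢
    rw [ih]
    fin_cases a <;> simp [fibMorphism] <;> omega

theorem length_applyMorphism (w : List (Fin 2)) :
    (applyMorphism fibMorphism w).length = w.length + w.count 0 := by
  induction w with
  | nil => rfl
  | cons a w ih =>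
    simp only [applyMorphism, List.flatMap_cons, List.length_append, List.length_cons] at ih ⊢
    rw [ih]
    fin_cases a <;> simp [fibMorphism] <;> omega

/-- Desubstitution: a cut can only fall between two blocks or inside a block 01. This drives the
induction in `count_eq_floor_of_prefix`. -/
theorem prefix_applyMorphism {u v : List (Fin 2)} (h : u <+: applyMorphism fibMorphism v) :
    ∃ w, w <+: v ∧
      (u = applyMorphism fibMorphism w ∨ u = applyMorphism fibMorphism w ++ [0]) := by
  induction v generalizing u with
  | nil =>
    have : u = [] := by simpa [applyMorphism] using h
    exact ⟨[], List.prefix_refl _, Or.inl this⟩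
  | cons a v ih =>
    rcases u with _ | ⟨b, u⟩
    · exact ⟨[], List.nil_prefix, Or.inl rfl⟩
    have h0 : applyMorphism fibMorphism (a :: v) =
        fibMorphism a ++ applyMorphism fibMorphism v := by simp [applyMorphism]
    rw [h0] at h
    fin_cases a
    · simp only [fibMorphism, Fin.zero_eta, Matrix.cons_val_zero, List.cons_append,
        List.nil_append, List.cons_prefix_cons] at h
      obtain ⟨rfl, h⟩ := h
      rcases u with _ | ⟨c, u⟩
      · exact ⟨[], List.nil_prefix, Or.inr rfl⟩
      rw [List.cons_prefix_cons] at h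
      obtain ⟨rfl, h⟩ := h
      obtain ⟨w, hw, h | h⟩ := ih h
      · exact ⟨0 :: w, by simpa using hw, Or.inl (by simp [h, applyMorphism, fibMorphism])⟩
      · exact ⟨0 :: w, by simpa using hw, Or.inr (by simp [h, applyMorphism, fibMorphism])⟩
    · simp only [fibMorphism, Fin.mk_one, Matrix.cons_val_one, Matrix.cons_val_fin_one,
        List.cons_append, List.nil_append, List.cons_prefix_cons] at h
      obtain ⟨rfl, h⟩ := h
      obtain ⟨w, hw, h | h⟩ := ih h
      · exact ⟨1 :: w, by simpa using hw, Or.inl (by simp [h, applyMorphism, fibMorphism])⟩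
      · exact ⟨1 :: w, by simpa using hw, Or.inr (by simp [h, applyMorphism, fibMorphism])⟩

/-- The number of zeros in the prefixes of the Fibonacci word. -/
theorem count_eq_floor_of_prefix {m : ℕ} {u : List (Fin 2)} (h : u <+: fibIterate m) :
    (u.count 0 : ℤ) = ⌊((u.length : ℝ) + 1) * invGolden⌋ := by
  have hs := half_lt_invGolden
  have hs1 := invGolden_lt_one
  have hsq := invGolden_sq
  induction m generalizing u with
  | zero =>
    have hu : u = [] ∨ u = [0] := by
      rcases u with _ | ⟨b, u⟩
      · simp
      · simpa [fibIterate, List.cons_prefix_cons] using h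
    symm
    rw [Int.floor_eq_iff]
    rcases hu with rfl | rfl
    · simp only [List.count_nil, List.length_nil]
      push_cast
      constructor <;> linarith
    · simp only [List.count_singleton_self, List.length_singleton]
      push_cast
      constructor <;> linarith
  | succ m ih =>
    rw [fibIterate_succ] at h
    obtain ⟨w, hw, hu⟩ := prefix_applyMorphism h
    have hc := ih hw
    symm
    rw [eq_comm, Int.floor_eq_iff] at hc
    rw [Int.floor_eq_iff]
    push_cast at hc ⊢
    obtain ⟨h1, h2⟩ := hc
    -- Irrationality makes the lower floor bound strict; the strict upper bound for the image needs
    -- this.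
    have hirr : Irrational (((w.length + 1 : ℕ) : ℝ) * invGolden) :=
      irrational_invGolden.natCast_mul (by omega)
    have hne := hirr.ne_nat (w.count 0)
    push_cast at hne
    have h3 := mul_lt_mul_of_pos_right (lt_of_le_of_ne h1 hne.symm) invGolden_pos
    have h4 := mul_lt_mul_of_pos_right h2 invGolden_pos
    rcases hu with rfl | rfl
    · rw [count_applyMorphism, length_applyMorphism]
      push_cast
      constructor <;> nlinarith
    · rw [List.count_append, List.length_append, count_applyMorphism, length_applyMorphism]
      simp only [List.count_singleton_self, List.length_singleton]
      push_cast
      constructor <;> nlinarith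

/-! ### The Rote-Fibonacci word as a coding of a rotation -/

/-- The first letter written from a given state. -/
def State.letter : State → ℕ
  | .q₀ => 0
  | .q₁ => 1

/-- The blocks written by the transducer have the lengths of the morphism's blocks, and each of the
latter has a single zero, at its start. Counting zeros therefore counts the blocks begun, and the
written letter alternates from block to block. -/
theorem transduce_getElem (q : State) (w : List (Fin 2)) (k : ℕ)
    (hk : k < (transduce q w).length) :
    ((transduce q w)[k]).val =
      (q.letter + ((applyMorphism fibMorphism w).take (k + 1)).count 0 + 1) % 2 := by
  induction w generalizing q k with
  | nil => simp [transduce] at hk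
  | cons a w ih =>
    have h0 : applyMorphism fibMorphism (a :: w) =
        fibMorphism a ++ applyMorphism fibMorphism w := by simp [applyMorphism]
    rw [h0]
    fin_cases a
    · rcases k with _ | _ | k
      · cases q <;> simp [transduce, out, fibMorphism, State.letter]
      · cases q <;> simp [transduce, out, fibMorphism, State.letter]
      · have hk' : k < (transduce (next q 0) w).length := by
          cases q <;> simp [transduce, out] at hk ⊢ <;> omega
        have := ih (next q 0) k hk'
        cases q <;> simp [transduce, out, fibMorphism, next, State.letter] at this ⊢ <;> omega
    · rcases k with _ | k
      · cases q <;> simp [transduce, out, fibMorphism, State.letter]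
      · have hk' : k < (transduce (next q 1) w).length := by
          cases q <;> simp [transduce, out] at hk ⊢ <;> omega
        have := ih (next q 1) k hk'
        cases q <;> simp [transduce, out, fibMorphism, next, State.letter] at this ⊢ <;> omega

/-- The Rote-Fibonacci word codes a rotation. -/
theorem roteFibWord_val (n : ℕ) :
    ((roteFibWord n).val : ℤ) = (⌊((n : ℝ) + 2) * invGolden⌋ + 1) % 2 := by
  have hpre : (applyMorphism fibMorphism (factorAt fibWord 0 (n + 1))).take (n + 1) <+:
      fibIterate (n + 2) := by
    refine (List.take_prefix _ _).trans ?_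
    rw [fibIterate_succ (n + 1)]
    exact applyMorphism_prefix _ (factorAt_fibWord_prefix (n + 1))
  have hlen : ((applyMorphism fibMorphism (factorAt fibWord 0 (n + 1))).take (n + 1)).length
      = n + 1 := by
    rw [List.length_take, min_eq_left]
    simpa [factorAt] using length_le_length_applyMorphism (factorAt fibWord 0 (n + 1))
  have h := count_eq_floor_of_prefix hpre
  rw [hlen] at h
  push_cast at h
  rw [show (n : ℝ) + 1 + 1 = n + 2 by ring] at h
  rw [← h, roteFibWord, transduce_getElem]
  simp [State.letter]

theorem roteFibWord_eq_add_iff {p : ℕ} {m : ℤ} (hm : |p * invGolden - 2 * m| < 1) (k : ℕ) :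
    roteFibWord k = roteFibWord (k + p) ↔
      ⌊((k : ℝ) + 2) * invGolden⌋ = ⌊((k : ℝ) + 2) * invGolden + (p * invGolden - 2 * m)⌋ := by
  have h1 := roteFibWord_val k
  have h2 := roteFibWord_val (k + p)
  have e : (((k + p : ℕ) : ℝ) + 2) * invGolden =
      ((k : ℝ) + 2) * invGolden + (p * invGolden - 2 * m) + ((2 * m : ℤ) : ℝ) := by
    push_cast
    ring
  rw [e, Int.floor_add_intCast] at h2
  rw [Fin.ext_iff]
  generalize ((k : ℝ) + 2) * invGolden = y at *
  generalize (p : ℝ) * invGolden - 2 * m = d at *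
  obtain ⟨d1, d2⟩ := abs_lt.mp hm
  have b1 : ⌊y + d⌋ ≤ ⌊y⌋ + 1 := by
    rw [← Int.floor_add_one]
    exact Int.floor_le_floor (by linarith)
  have b2 : ⌊y⌋ - 1 ≤ ⌊y + d⌋ := by
    rw [← Int.floor_sub_one]
    exact Int.floor_le_floor (by linarith)
  omega

/-! ### Upper bound for the exponents -/

theorem fib_add_two_sub_one_le (n : ℕ) :
    (Nat.fib (n + 2) : ℝ) - 1 ≤ (2 + invGolden) * Nat.fib n ∧
      (2 + invGolden) * Nat.fib n ≤ (Nat.fib (n + 2) : ℝ) + 1 := by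
  have f := fib_mul_invGolden (n + 1)
  have f0 := fib_mul_invGolden n
  have key : (Nat.fib (n + 2) : ℝ) - (2 + invGolden) * Nat.fib n = (-1) ^ n * invGolden ^ n := by
    rw [Nat.fib_add_two] at f
    rw [Nat.fib_add_two]
    push_cast at f ⊢
    have e := invGolden_pow_add_two n
    rw [pow_succ (-1 : ℝ)] at f
    linear_combination -f + ((-1) ^ n) * e + f0
  have h1 := invGolden_pow_le_one n
  have h0 := invGolden_pow_pos n
  rcases neg_one_pow_eq_or ℝ n with h | h <;> rw [h] at key <;> constructor <;> linarith

/-- Repetitions of period `p` in the Rote-Fibonacci word have length at most `(3 + invGolden) p`. -/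
theorem length_le_of_forall_eq {i L p : ℕ} (hp : 1 ≤ p)
    (h : ∀ k, k + p < L → roteFibWord (i + k) = roteFibWord (i + k + p)) :
    (L : ℝ) ≤ (3 + invGolden) * p := by
  -- With 2m the even integer nearest to pφ, |d| ≤ 1; irrationality excludes equality.
  set m : ℤ := round ((p : ℝ) * invGolden / 2) with hmdef
  have hirr : Irrational ((p : ℝ) * invGolden) := irrational_invGolden.natCast_mul (by omega)
  have hm : |p * invGolden - 2 * m| < 1 := by
    have h1 := abs_sub_round ((p : ℝ) * invGolden / 2)
    rw [← hmdef] at h1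
    have h2 := abs_le.mp h1
    rw [abs_lt]
    constructor
    · refine lt_of_le_of_ne (by linarith [h2.1]) fun hE => ?_
      refine hirr.ne_int (2 * m - 1) ?_
      push_cast
      linarith
    · refine lt_of_le_of_ne (by linarith [h2.2]) fun hE => ?_
      refine hirr.ne_int (2 * m + 1) ?_
      push_cast
      linarith
  have hne : 0 < |p * invGolden - 2 * m| := by
    rw [abs_pos, sub_ne_zero]
    have := hirr.ne_int (2 * m)
    push_cast at this
    exact this
  have hex : ∃ n : ℕ, invGolden ^ n ≤ |p * invGolden - 2 * m| := by
    obtain ⟨n, hn⟩ := exists_pow_lt_of_lt_one hne invGolden_lt_one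
    exact ⟨n, hn.le⟩
  classical
  obtain ⟨n, hn, hmin⟩ : ∃ n : ℕ, invGolden ^ n ≤ |p * invGolden - 2 * m| ∧
      ∀ l < n, |p * invGolden - 2 * m| < invGolden ^ l :=
    ⟨Nat.find hex, Nat.find_spec hex, fun l hl => not_le.mp (Nat.find_min hex hl)⟩
  rcases n with _ | n
  · simp only [pow_zero] at hn
    linarith
  have hpf : Nat.fib (n + 1) ≤ p := by
    refine fib_le_of_abs_lt n p (2 * m) hp ?_
    push_cast
    exact hmin n (by omega)
  have hL : L < p + Nat.fib (n + 1 + 2) := by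
    by_contra hL
    push Not at hL
    -- The arc starts at the smaller of y and y + d, so that the integer found separates the two
    -- floors.
    rcases le_abs'.mp hn with hd | hd
    · obtain ⟨j, hj, z, h1, h2⟩ := exists_rotation_mem (n + 1)
        (((i : ℝ) + 2) * invGolden + (p * invGolden - 2 * m))
      have := (roteFibWord_eq_add_iff hm (i + j)).mp (h j (by omega))
      have e : (((i + j : ℕ) : ℝ) + 2) * invGolden = ((i : ℝ) + 2) * invGolden + j * invGolden := by
        push_cast
        ring
      rw [e] at this
      have g1 : z ≤ ⌊((i : ℝ) + 2) * invGolden + j * invGolden⌋ := Int.le_floor.mpr (by linarith)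
      rw [this, Int.le_floor] at g1
      linarith
    · obtain ⟨j, hj, z, h1, h2⟩ := exists_rotation_mem (n + 1) (((i : ℝ) + 2) * invGolden)
      have := (roteFibWord_eq_add_iff hm (i + j)).mp (h j (by omega))
      have e : (((i + j : ℕ) : ℝ) + 2) * invGolden = ((i : ℝ) + 2) * invGolden + j * invGolden := by
        push_cast
        ring
      rw [e] at this
      have g1 : z ≤ ⌊((i : ℝ) + 2) * invGolden + j * invGolden + (p * invGolden - 2 * m)⌋ :=
        Int.le_floor.mpr (by linarith)
      rw [← this, Int.le_floor] at g1
      linarith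
  have hL' : (L : ℝ) + 1 ≤ p + Nat.fib (n + 1 + 2) := by exact_mod_cast hL
  have hf := (fib_add_two_sub_one_le (n + 1)).1
  have hpf' : (Nat.fib (n + 1) : ℝ) ≤ p := by exact_mod_cast hpf
  nlinarith [invGolden_pos]

theorem exponent_le {w : List (Fin 2)} (hw : IsFactor w roteFibWord) :
    exponent w ≤ 3 + invGolden := by
  obtain ⟨i, L, rfl⟩ := hw
  obtain ⟨h1, h2, -⟩ := minPeriod_spec (factorAt roteFibWord i L)
  have hpos : (0 : ℝ) < minPeriod (factorAt roteFibWord i L) := by exact_mod_cast h1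
  rw [exponent, div_le_iff₀ hpos]
  generalize minPeriod (factorAt roteFibWord i L) = p at *
  have hl : (factorAt roteFibWord i L).length = L := by simp [factorAt]
  rw [hl]
  refine length_le_of_forall_eq (i := i) h1 fun k hk => ?_
  have hk' : k < L := by omega
  have := List.hasPeriod_iff_getElem?.mp h2 k (by rw [hl]; omega)
  simpa [factorAt, List.getElem?_range, hk, hk', add_assoc] using this

/-! ### Long repetitions -/

theorem even_fib_six_mul (k : ℕ) : 2 ∣ Nat.fib (6 * k) :=
  (show 2 ∣ Nat.fib 6 by decide).trans (Nat.fib_dvd _ _ (dvd_mul_right 6 k))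

/-- Here d = φ^(n+1): n even fixes the sign, F(n) even allows 2m = F(n). Modulo 1, the points
compared are jφ - φ^(n+2) and jφ + φ^(n+3). For 1 ≤ j < F(n+3) every integer is at distance at least
φ^(n+2) from jφ, so none separates them. -/
theorem roteFibWord_run {n j : ℕ} (hn : Even n) (hf : 2 ∣ Nat.fib n) (hj1 : 1 ≤ j)
    (hj : j < Nat.fib (n + 3)) :
    roteFibWord (Nat.fib (n + 2) + j - 2) =
      roteFibWord (Nat.fib (n + 2) + j - 2 + Nat.fib (n + 1)) := by
  obtain ⟨m, hm⟩ := hf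
  have f0 := fib_mul_invGolden n
  have f1 := fib_mul_invGolden (n + 1)
  rw [hn.neg_one_pow] at f0
  rw [hn.add_one.neg_one_pow] at f1
  have e0 := invGolden_pow_add_two n
  have e1 := invGolden_pow_add_two (n + 1)
  have p1 := invGolden_pow_pos (n + 1)
  have p2 := invGolden_pow_pos (n + 2)
  have e2 := invGolden_pow_add_two (n + 2)
  have p4 := invGolden_pow_pos (n + 2 + 2)
  simp only [show n + 1 + 1 = n + 2 from rfl, show n + 1 + 2 = n + 3 from rfl] at *
  have hd : (Nat.fib (n + 1) : ℝ) * invGolden - 2 * (m : ℤ) = invGolden ^ (n + 1) := by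
    rw [f0, hm]
    push_cast
    ring
  have hlt : |(Nat.fib (n + 1) : ℝ) * invGolden - 2 * (m : ℤ)| < 1 := by
    rw [hd, abs_of_pos p1]
    exact pow_lt_one₀ invGolden_pos.le invGolden_lt_one (by omega)
  rw [roteFibWord_eq_add_iff hlt, hd]
  have hpos : 0 < Nat.fib (n + 2) := Nat.fib_pos.mpr (by omega)
  have e : (((Nat.fib (n + 2) + j - 2 : ℕ) : ℝ) + 2) * invGolden =
      (j * invGolden - invGolden ^ (n + 2)) + ((Nat.fib (n + 1) : ℤ) : ℝ) := by
    rw [Nat.cast_sub (by omega)]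
    push_cast
    linarith
  rw [e, add_right_comm, Int.floor_add_intCast, Int.floor_add_intCast]
  congr 1
  have far (q : ℤ) : invGolden ^ (n + 2) ≤ |j * invGolden - q| := by
    by_contra hlt
    have := fib_le_of_abs_lt (n + 2) j q hj1 (not_le.mp hlt)
    exact absurd hj (not_lt.mpr this)
  symm
  rw [Int.floor_eq_iff]
  constructor
  · linarith [Int.floor_le ((j : ℝ) * invGolden - invGolden ^ (n + 2))]
  · have h1 := Int.lt_floor_add_one ((j : ℝ) * invGolden - invGolden ^ (n + 2))
    have h2 := far (⌊(j : ℝ) * invGolden - invGolden ^ (n + 2)⌋ + 1)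
    push_cast at h2
    rcases le_abs'.mp h2 with h | h <;> linarith

theorem exists_factor_le_exponent (k : ℕ) :
    ∃ w, (w ≠ [] ∧ IsFactor w roteFibWord) ∧
      3 + invGolden - 2 / (Nat.fib (6 * k + 1) : ℝ) ≤ exponent w := by
  set n := 6 * k with hn
  have hp : 0 < Nat.fib (n + 1) := Nat.fib_pos.mpr (by omega)
  have hp2 : 0 < Nat.fib (n + 2) := Nat.fib_pos.mpr (by omega)
  have hp3 : 0 < Nat.fib (n + 3) := Nat.fib_pos.mpr (by omega)
  -- One period plus the F(n+3) - 1 matches; the starting index is that of j = 1 in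
  -- `roteFibWord_run`.
  set L := Nat.fib (n + 1) + Nat.fib (n + 3) - 1 with hL
  set w := factorAt roteFibWord (Nat.fib (n + 2) - 1) L with hw
  have hl : w.length = L := by simp [hw, factorAt]
  have hne : w ≠ [] := by
    rw [← List.length_pos_iff, hl]
    omega
  refine ⟨w, ⟨hne, _, _, rfl⟩, ?_⟩
  have hper : w.HasPeriod (Nat.fib (n + 1)) := by
    rw [List.hasPeriod_iff_getElem?]
    intro j hj
    rw [hl] at hj
    have hj1 : j < L := by omega
    have hj2 : j + Nat.fib (n + 1) < L := by omega
    have := roteFibWord_run (n := n) (j := j + 1) (by rw [hn]; exact ⟨3 * k, by ring⟩)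
      (even_fib_six_mul k) (by omega) (by omega)
    simp only [hw, factorAt, List.getElem?_map, List.getElem?_range hj1,
      List.getElem?_range hj2, Option.map_some]
    convert congrArg some this using 3 <;> omega
  have hmin : minPeriod w ≤ Nat.fib (n + 1) := Nat.sInf_le ⟨hp, hper⟩
  have hm1 := (minPeriod_spec w).1
  have hm1' : (0 : ℝ) < minPeriod w := by exact_mod_cast hm1
  have hpR : (0 : ℝ) < Nat.fib (n + 1) := by exact_mod_cast hp
  have hmin' : (minPeriod w : ℝ) ≤ Nat.fib (n + 1) := by exact_mod_cast hmin
  have hf := (fib_add_two_sub_one_le (n + 1)).2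
  have hLR : (L : ℝ) = Nat.fib (n + 1) + Nat.fib (n + 3) - 1 := by
    rw [hL, Nat.cast_sub (by omega)]
    push_cast
    ring
  calc 3 + invGolden - 2 / (Nat.fib (n + 1) : ℝ) ≤ L / (Nat.fib (n + 1) : ℝ) := by
        rw [le_div_iff₀ hpR, sub_mul, div_mul_cancel₀ _ hpR.ne', hLR]
        linarith
    _ ≤ L / (minPeriod w : ℝ) := div_le_div_of_nonneg_left (by positivity) hm1' hmin'
    _ = exponent w := by rw [exponent, hl]

theorem tendsto_fib_atTop : Filter.Tendsto (fun k => (Nat.fib (6 * k + 1) : ℝ))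
    Filter.atTop Filter.atTop := by
  refine tendsto_natCast_atTop_atTop.comp (Filter.tendsto_atTop_mono (f := fun k => k) ?_
    Filter.tendsto_id)
  intro k
  have := Nat.le_fib_add_one (6 * k + 1)
  omega

end RoteFibonacci

open RoteFibonacci in
theorem mainTheorem5 :
    RoteFibonacci.criticalExponent RoteFibonacci.roteFibWord
      = ((2 + (1 + Real.sqrt 5) / 2 : ℝ) : EReal) := by
  have hval : (2 + (1 + Real.sqrt 5) / 2 : ℝ) = 3 + invGolden := by
    unfold invGolden
    ring
  rw [hval]
  apply le_antisymm
  · exact iSup₂_le fun w hw => EReal.coe_le_coe_iff.mpr (exponent_le hw.2)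
  · have hlim : Filter.Tendsto
        (fun k : ℕ => ((3 + invGolden - 2 / (Nat.fib (6 * k + 1) : ℝ) : ℝ) : EReal))
        Filter.atTop (nhds ((3 + invGolden : ℝ) : EReal)) := by
      refine EReal.tendsto_coe.mpr ?_
      simpa using tendsto_const_nhds.sub
        (Filter.Tendsto.const_div_atTop tendsto_fib_atTop 2)
    refine le_of_tendsto' hlim fun k => ?_
    obtain ⟨w, hw, hk⟩ := exists_factor_le_exponent k
    exact (EReal.coe_le_coe_iff.mpr hk).trans
      (le_iSup₂ (f := fun (w : List (Fin 2)) (_ : w ≠ [] ∧ IsFactor w roteFibWord) =>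
        (exponent w : EReal)) w hw)
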